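/- Let $p$ be a prime number, $n\ge 1$ an integer, and $K/F$ a Galois extension of fields whose group $G=\operatorname{Gal}(K/F)$ is cyclic of order $p^n$. Suppose that $F$ contains a primitive $p$-th root of unity (in particular $\operatorname{char} F\ne p$) and, if $p=2$, that $n>1$ or $-1\in N_{K/F}(K^\times)$. Let $J=K^\times/K^{\times p}$, an $\mathbb{F}_p[G]$-module, and write $[\gamma]\in J$ for the class of $\gamma\in K^\times$ and $[f]_F\in F^\times/F^{\times p}$ for the class of $f\in F^\times$. Let $l(\gamma)$ be the dimension over $\mathbb{F}_p$ of the $\mathbb{F}_p[G]$-submodule of $J$ generated by $[\gamma]$. For $0\le i\le n$ let $K_i$ be the intermediate field of $K/F$ with $[K_i:F]=p^i$, and let $[K_i^\times]$ be the image of $K_i^\times$ in $J$; put $K_{-\infty}^\times=\{1\}$ and $p^{-\infty}=0$. Let $$m=i(K/F)=\min\{\,i\in\{-\infty,0,1,\dots,n\} : \exists\,\delta\in K^\times \text{ with } [N_{K/F}(\delta)]_F\neq[1]_F \text{ and } [\delta]^{\tau-1}\in[K_i^\times]\ \text{for all } \tau\in G\,\},$$ and call $\delta\in K^\times$ exceptional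 if $[N_{K/F}(\delta)]_F\ne[1]_F$ and $[\delta]^{\tau-1}\in[K_m^\times]$ for all $\tau\in G$. Then the set whose minimum defines $m$ is non-empty (so that $m$ is well defined and exceptional elements exist), and $m<n$. Every exceptional element $\delta$ satisfies $l(\delta)=p^m+1$. Moreover, $p^m+1$ is the minimal value of $l(z)$ over all $z\in K^\times$ with $[N_{K/F}(z)]_F\neq[1]_F$. -/

import Mathlib

/-- The group `K^× / K^{×p}` of `p`-th power classes of a field `K`, written additively. -/
def PowerClasses (p : ℕ) (K : Type*) [Field K] : Type _ :=
  Additive (Kˣ ⧸ (powMonoidHom p : Kˣ →* Kˣ).range)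

namespace PowerClasses

noncomputable instance (p : ℕ) (K : Type*) [Field K] : AddCommGroup (PowerClasses p K) :=
  inferInstanceAs (AddCommGroup (Additive (Kˣ ⧸ (powMonoidHom p : Kˣ →* Kˣ).range)))

/-- The class `[γ]` of `γ ∈ K^×`, as a homomorphism (so `[1]` is `0`). -/
noncomputable def mk (p : ℕ) {K : Type*} [Field K] : Additive Kˣ →+ PowerClasses p K :=
  MonoidHom.toAdditive (QuotientGroup.mk' (powMonoidHom p : Kˣ →* Kˣ).range)

/-- The class `[γ]` of `γ ∈ K^×`. -/
noncomputable def cls (p : ℕ) {K : Type*} [Field K] (γ : Kˣ) : PowerClasses p K :=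
  mk p (Additive.ofMul γ)

theorem nsmul_eq_zero (p : ℕ) (K : Type*) [Field K] (x : PowerClasses p K) : p • x = 0 := by
  obtain ⟨γ, rfl⟩ := QuotientGroup.mk'_surjective (powMonoidHom p : Kˣ →* Kˣ).range x
  exact (QuotientGroup.eq_one_iff (N := (powMonoidHom p : Kˣ →* Kˣ).range) (γ ^ p)).2 ⟨γ, rfl⟩

/-- `K^× / K^{×p}` is a vector space over the field with `p` elements. -/
noncomputable instance (p : ℕ) (K : Type*) [Field K] : Module (ZMod p) (PowerClasses p K) :=
  AddCommGroup.zmodModule (nsmul_eq_zero p K)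

/-- The additive map on classes induced by an automorphism `τ` of `K`: `[γ] ↦ [τ γ]`. -/
noncomputable def galMap (p : ℕ) (F K : Type*) [Field F] [Field K] [Algebra F K] (τ : K ≃ₐ[F] K) :
    PowerClasses p K →+ PowerClasses p K :=
  MonoidHom.toAdditive (QuotientGroup.map (powMonoidHom p : Kˣ →* Kˣ).range
    (powMonoidHom p : Kˣ →* Kˣ).range (Units.map (τ : K →* K)) (by
      rintro _ ⟨x, rfl⟩
      exact ⟨Units.map (τ : K →* K) x, by simp⟩))

theorem galMap_cls (p : ℕ) (F K : Type*) [Field F] [Field K] [Algebra F K] (τ : K ≃ₐ[F] K)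
    (γ : Kˣ) : galMap p F K τ (cls p γ) = cls p (Units.map (τ : K →* K) γ) := rfl

theorem cls_surjective (p : ℕ) (K : Type*) [Field K] :
    Function.Surjective (cls p : Kˣ → PowerClasses p K) :=
  fun x => QuotientGroup.mk'_surjective (powMonoidHom p : Kˣ →* Kˣ).range x

/-- The Galois action on `J = K^× / K^{×p}`, as a representation of `Gal(K/F)` over the field with
`p` elements. -/
noncomputable def galRep (p : ℕ) (F K : Type*) [Field F] [Field K] [Algebra F K] :
    Representation (ZMod p) (K ≃ₐ[F] K) (PowerClasses p K) where
  toFun τ := (galMap p F K τ).toZModLinearMap p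
  map_one' := by
    ext x
    obtain ⟨γ, rfl⟩ := cls_surjective p K x
    exact (galMap_cls p F K 1 γ).trans (congrArg (cls p) (Units.ext rfl))
  map_mul' τ υ := by
    ext x
    obtain ⟨γ, rfl⟩ := cls_surjective p K x
    exact (galMap_cls p F K (τ * υ) γ).trans (congrArg (cls p) (Units.ext rfl))

/-- The cyclic `𝔽_p[G]`-submodule `M_γ` of `J = K^× / K^{×p}` generated by `[γ]`, where
`G = Gal(K/F)`. -/
noncomputable def cyclicSubmodule (p : ℕ) (F : Type*) {K : Type*} [Field F] [Field K] [Algebra F K]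
    (γ : Kˣ) : Submodule (MonoidAlgebra (ZMod p) (K ≃ₐ[F] K)) (galRep p F K).asModule :=
  Submodule.span _ {(galRep p F K).asModuleEquiv.symm (cls p γ)}

/-- The length `l(γ)`: the dimension over the field with `p` elements of the cyclic
`𝔽_p[G]`-submodule of `J` generated by `[γ]`. -/
noncomputable def length (p : ℕ) (F : Type*) {K : Type*} [Field F] [Field K] [Algebra F K]
    (γ : Kˣ) : ℕ :=
  Module.finrank (ZMod p) ((cyclicSubmodule p F γ).restrictScalars (ZMod p))

/-- The class `[N_{K/F}(γ)]_F` in `F^× / F^{×p}`. -/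
noncomputable def normCls (p : ℕ) (F : Type*) {K : Type*} [Field F] [Field K] [Algebra F K]
    (γ : Kˣ) : PowerClasses p F :=
  cls p (Units.map (Algebra.norm F : K →* F) γ)

/-- The intermediate field `K_i` of degree `p ^ i` over `F`. It is the join of all intermediate
fields of that degree; in a cyclic extension of degree `p ^ n` there is exactly one of them for
each `i ≤ n`. -/
noncomputable def layer (p : ℕ) (F K : Type*) [Field F] [Field K] [Algebra F K] (i : ℕ) :
    IntermediateField F K :=
  sSup {L : IntermediateField F K | Module.finrank F L = p ^ i}

/-- The image `[K_i^×]` of `K_i^×` in `J`, with `K_{-∞}^× = {1}`. The bottom element of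
`WithBot ℕ` plays the role of `-∞`. -/
noncomputable def layerClasses (p : ℕ) (F K : Type*) [Field F] [Field K] [Algebra F K] :
    WithBot ℕ → AddSubgroup (PowerClasses p K)
  | ⊥ => ⊥
  | (i : ℕ) => (Subgroup.toAddSubgroup
      (Units.map ((layer p F K i).val : layer p F K i →* K)).range).map (mk p)

/-- `δ` has `[N_{K/F}(δ)]_F ≠ [1]_F` and `[δ]^{τ-1} ∈ [K_i^×]` for all `τ ∈ Gal(K/F)`. -/
def IsWitness (p : ℕ) (F : Type*) {K : Type*} [Field F] [Field K] [Algebra F K]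
    (i : WithBot ℕ) (δ : Kˣ) : Prop :=
  normCls p F δ ≠ 0 ∧
    ∀ τ : K ≃ₐ[F] K, galRep p F K τ (cls p δ) - cls p δ ∈ layerClasses p F K i

/-- The set of those `i ∈ {-∞, 0, 1, …, n}` of which `i(K/F)` is the minimum. -/
def indexSet (p n : ℕ) (F K : Type*) [Field F] [Field K] [Algebra F K] : Set (WithBot ℕ) :=
  {i | i ≤ (n : WithBot ℕ) ∧ ∃ δ : Kˣ, IsWitness p F i δ}

open Classical in
/-- The invariant `i(K/F)`, the minimum of `indexSet` (with value `n + 1`, outside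
`{-∞, 0, …, n}`, should that set be empty). -/
noncomputable def index (p n : ℕ) (F K : Type*) [Field F] [Field K] [Algebra F K] : WithBot ℕ :=
  if h : (indexSet p n F K).Nonempty then
    (wellFounded_lt (α := WithBot ℕ)).min (indexSet p n F K) h
  else ((n + 1 : ℕ) : WithBot ℕ)

/-- Exceptional elements of `K/F`. -/
def IsExceptional (p n : ℕ) (F : Type*) {K : Type*} [Field F] [Field K] [Algebra F K]
    (δ : Kˣ) : Prop :=
  IsWitness p F (index p n F K) δ

/-- The power `p ^ i` for `i ∈ {-∞, 0, 1, …}`, with `p ^ (-∞) = 0`. -/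
def botPow (p : ℕ) : WithBot ℕ → ℕ
  | ⊥ => 0
  | (i : ℕ) => p ^ i

end PowerClasses

/-! ### Geometric sums and a divisibility by `p` -/

section

open Finset

/-! Let `σ` generate `G` and write `N` for the norm to `F`. In characteristic `p`, `(σ - 1)^(p^i) =
σ^(p^i) - 1` on `J`, and `l(γ) ≤ l` exactly when `(σ - 1)^l` kills `[γ]`. For a witness `δ` at level
`m`, `[δ]^(σ-1)` lies in `[K_m^×]`, which `σ^(p^m) - 1` kills; hence `l(δ) ≤ p^m + 1`.

For the lower bound, let `[N(z)] ≠ [1]` and `l(z) ≤ p^(i+1)` with `i + 1 < n`. Then `σ^(p^(i+1))`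
sends `z` to `z k^p`, and `ζ = N_{K/K_{i+1}}(k)` satisfies `ζ^p = 1`. If `ζ = 1`, Hilbert 90 puts
`z` in `K_{i+1}^× K^{×p}`, and then `N(z)` is a `p`-th power in `F` because `K_{i+1} ≠ K`. So `ζ` is
a nontrivial root of unity that is a norm from `K` to `K_{i+1}`.

The core, `exists_descent`, turns such a `ζ` into a witness at level `i`. Repeated use of Hilbert 90
yields `z'` with `z'^(σ-1)` in `K_i^× K^{×p}` and `N(z') = g^p`, where `g^(σ-1) = ζ`. All `p`-th
roots of `N(z')` differ from `g` by roots of unity of `F`, so none lies in `F`. Thus a minimal `m =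
i + 1` forces `l(z) > p^m`; the levels `-∞` and `0` are direct.

Finally `m < n`: at the top layer `K_n = K` every `ζ` is its own norm. Only `p = 2`, `n = 1` escapes
the descent, and there an element of norm `-1` gives a witness. -/

theorem Finset.sum_range_mul_pow {R : Type*} [CommSemiring R] (s : R) (a b : ℕ) :
    ∑ j ∈ range (a * b), s ^ j = (∑ j ∈ range a, s ^ j) * ∑ j ∈ range b, (s ^ a) ^ j := by
  induction b with
  | zero => simp
  | succ b ih =>
    rw [Nat.mul_succ, sum_range_add, ih, sum_range_succ _ b, mul_add]
    exact congrArg _ <| (sum_congr rfl fun j _ => by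
      rw [pow_add, pow_mul, mul_comm]).trans (sum_mul _ _ _).symm

/-- For `i = 0` the sum is `p^n (p^n - 1) / 2`; the halving costs a factor `p` only when `p = 2`,
and then `n > 1` leaves another. This is the sole reason the descent excludes `p = 2`, `n = 1`. -/
theorem Nat.Prime.dvd_pow_mul_sum_range {p n i : ℕ} (hp : p.Prime) (hi : i < n)
    (h2 : p = 2 → 1 < n) : p ∣ p ^ i * ∑ j ∈ range (p ^ (n - i)), j := by
  rcases Nat.eq_zero_or_pos i with rfl | hi0
  · refine Dvd.dvd.mul_left ?_ _
    have hS := sum_range_id_mul_two (p ^ (n - 0))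
    rw [Nat.sub_zero] at hS ⊢
    obtain ⟨k, rfl⟩ : ∃ k, n = k + 1 := ⟨n - 1, by omega⟩
    by_cases hp2 : p = 2
    · have hk : k ≠ 0 := by have := h2 hp2; omega
      subst hp2
      rw [pow_succ, mul_right_comm, Nat.mul_left_inj two_ne_zero] at hS
      rw [pow_succ, hS]
      exact (dvd_pow_self 2 hk).mul_right _
    · refine (Nat.Coprime.dvd_of_dvd_mul_right (n := 2) ?_ ?_)
      · exact (Nat.coprime_primes hp Nat.prime_two).2 hp2
      · rw [hS]
        exact (dvd_pow_self p k.succ_ne_zero).mul_right _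
  · exact (dvd_pow_self p hi0.ne').mul_right _

/-! ### The descent, in a module where `s` plays the role of `σ` -/

section Descent

variable {R M : Type*} [CommRing R] [AddCommGroup M] [Module R M]

theorem sum_pow_smul_of_smul_eq {t : R} {x : M} (h : t • x = x) (c : ℕ) :
    (∑ j ∈ range c, t ^ j) • x = c • x := by
  have hp : ∀ j : ℕ, t ^ j • x = x := fun j => by
    induction j with
    | zero => simp
    | succ j ih => rw [pow_succ, mul_smul, h, ih]
  simp [sum_smul, hp]

theorem sum_sum_pow_smul_of_smul_eq {t : R} {x : M} (h : t • x = x) (c : ℕ) :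
    (∑ j ∈ range c, ∑ l ∈ range j, t ^ l) • x = (∑ j ∈ range c, j) • x := by
  rw [Finset.sum_smul, Finset.sum_smul]
  exact sum_congr rfl fun j _ => sum_pow_smul_of_smul_eq h j

theorem sub_one_mul_sum_sum_pow (t : R) (c : ℕ) :
    (t - 1) * ∑ j ∈ range c, ∑ l ∈ range j, t ^ l = (∑ j ∈ range c, t ^ j) - c := by
  rw [mul_sum]
  simp only [mul_geom_sum, sum_sub_distrib, sum_const, card_range, nsmul_eq_mul, mul_one]

/-- If `(s - 1) z = u + p v` with `u` fixed by `s ^ p ^ i`, then the norm of `z` is divisible by `p`,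
with an explicit quotient `g`. -/
theorem exists_smul_eq_norm_smul {p n i : ℕ} (hp : p.Prime) (hi : i < n) (h2 : p = 2 → 1 < n)
    {s : R} {z u v : M} (hz : (s - 1) • z = u + p • v) (hu : s ^ p ^ i • u = u) :
    ∃ g : M, p • g = (∑ j ∈ range (p ^ n), s ^ j) • z ∧
      (s - 1) • g = (∑ j ∈ range (p ^ n), s ^ j) • v +
        p ^ (n - (i + 1)) • (∑ j ∈ range (p ^ i), s ^ j) • u := by
  obtain ⟨e, he⟩ := hp.dvd_pow_mul_sum_range hi h2
  have hc : p ^ (n - i) = p ^ (n - (i + 1)) * p := by rw [← pow_succ]; congr 1; omega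
  have hq : p ^ n = p ^ i * p ^ (n - i) := by rw [← pow_add]; congr 1; omega
  have hN := sum_range_mul_pow s (p ^ i) (p ^ (n - i))
  rw [← hq] at hN
  have hr : (∑ j ∈ range (p ^ i), s ^ j) * (s - 1) = s ^ p ^ i - 1 := geom_sum_mul s _
  have hEu := sum_sum_pow_smul_of_smul_eq hu (p ^ (n - i))
  have hE := sub_one_mul_sum_sum_pow (s ^ p ^ i) (p ^ (n - i))
  have hru : (∑ j ∈ range (p ^ i), s ^ j) • (∑ j ∈ range (p ^ i), s ^ j) • u =
      p ^ i • (∑ j ∈ range (p ^ i), s ^ j) • u := by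
    have : s • (∑ j ∈ range (p ^ i), s ^ j) • u = (∑ j ∈ range (p ^ i), s ^ j) • u := by
      rw [← sub_eq_zero]
      calc _ = ((∑ j ∈ range (p ^ i), s ^ j) * (s - 1)) • u := by module
        _ = 0 := by rw [hr, sub_smul, hu, one_smul, sub_self]
    exact sum_pow_smul_of_smul_eq this _
  generalize (∑ j ∈ range (p ^ n), s ^ j) = N at *
  generalize (∑ j ∈ range (p ^ i), s ^ j) = Nr at *
  generalize (∑ j ∈ range (p ^ (n - i)), ∑ l ∈ range j, (s ^ p ^ i) ^ l) = E at *
  generalize (∑ j ∈ range (p ^ (n - i)), (s ^ p ^ i) ^ j) = Nc at *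
  generalize (∑ j ∈ range (p ^ (n - i)), j) = S at *
  generalize s ^ p ^ i = t at *
  rw [hc] at hE
  generalize p ^ (n - (i + 1)) = b at *
  have hNc : Nc = (b * p : ℕ) + (t - 1) * E := by rw [hE]; ring
  -- With `t - 1 = Nr (s - 1)` and `Nc = b p + (t - 1) E`, the norm of `z` is `b p Nr z + Nr² E (u +
  -- p v)`. On the `t`-fixed `u`, `E` acts as `S` and `Nr²` as `p^i Nr`, and `p^i S = p e`. Every
  -- term is then divisible by `p`, and the witness is the quotient.
  refine ⟨b • Nr • z + e • Nr • u + (Nr * Nr * E) • v, ?_, ?_⟩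
  · have h1 : (Nr * Nr * E) • u = (p * e) • Nr • u := by
      rw [← he]
      calc _ = Nr • Nr • E • u := by module
        _ = S • Nr • Nr • u := by rw [hEu]; module
        _ = _ := by rw [hru]; module
    have h2 : N • z = (b * p) • Nr • z + (Nr * Nr * E) • u + p • (Nr * Nr * E) • v := by
      calc N • z = (b * p) • Nr • z + (Nr * Nr * E) • ((s - 1) • z) := by
            rw [hN, hNc, ← hr]; push_cast; module
        _ = _ := by rw [hz]; module
    rw [h2, h1]; module
  · have hs0 : (s - 1) • Nr • u = 0 := by
      rw [smul_smul, mul_comm, hr, sub_smul, hu, one_smul, sub_self]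
    have hv : ((s - 1) * (Nr * Nr * E)) • v = N • v - (b * p) • Nr • v := by
      have : (s - 1) * (Nr * Nr * E) = N - ((b * p : ℕ) : R) * Nr := by
        rw [hN, hNc, ← hr]; ring
      rw [this]; push_cast; module
    calc _ = b • Nr • ((s - 1) • z) + e • ((s - 1) • Nr • u) +
          ((s - 1) * (Nr * Nr * E)) • v := by module
      _ = _ := by rw [hz, hs0, hv]; module

/-- A norm from the `(i + 1)`-st layer which is fixed by `s` and killed by `p` gives rise to an
element `z` for which `(s - 1) z` is, modulo `p`, in the `i`-th layer. -/
theorem exists_descent {p n i : ℕ} (hp : p.Prime) (hi : i < n) (h2 : p = 2 → 1 < n) {s : R}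
    (h90 : ∀ j ≤ n, ∀ x : M, (∑ t ∈ range (p ^ (n - j)), (s ^ p ^ j) ^ t) • x = 0 →
      ∃ y : M, (s ^ p ^ j - 1) • y = x)
    {ζ k : M} (hζ : s • ζ = ζ) (hpζ : p • ζ = 0)
    (hk : (∑ t ∈ range (p ^ (n - (i + 1))), (s ^ p ^ (i + 1)) ^ t) • k = ζ) :
    ∃ z u v g : M, (s - 1) • z = u + p • v ∧ s ^ p ^ i • u = u ∧
      p • g = (∑ j ∈ range (p ^ n), s ^ j) • z ∧ (s - 1) • g = ζ := by
  have hc : p ^ (n - i) = p ^ (n - (i + 1)) * p := by rw [← pow_succ]; congr 1; omega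
  have hNr := sum_range_mul_pow s (p ^ i) (p ^ (n - i))
  have hNa := sum_range_mul_pow s (p ^ (i + 1)) (p ^ (n - (i + 1)))
  rw [← pow_add, show i + (n - i) = n by omega] at hNr
  rw [← pow_add, show i + 1 + (n - (i + 1)) = n by omega] at hNa
  have hr : (∑ j ∈ range (p ^ i), s ^ j) * (s - 1) = s ^ p ^ i - 1 := geom_sum_mul s _
  have ha : (∑ j ∈ range (p ^ (i + 1)), s ^ j) * (s - 1) = s ^ p ^ (i + 1) - 1 := geom_sum_mul s _
  -- The norm of `k` to `K_{i+1}` is the `s`-fixed `ζ`, so `(s - 1) k` has trivial norm there.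
  -- Subtracting the partial sum over `w` from `k` leaves `f`, an element of `F`.
  obtain ⟨w, hw⟩ := h90 (i + 1) hi ((s - 1) • k) (by
    rw [smul_comm, hk, sub_smul, hζ, one_smul, sub_self])
  obtain ⟨f, rfl⟩ : ∃ f, k = f + (∑ j ∈ range (p ^ (i + 1)), s ^ j) • w :=
    ⟨k - _, (sub_add_cancel _ _).symm⟩
  have hf : (s - 1) • f = 0 := by
    rw [smul_add, smul_smul, mul_comm (s - 1), ha, right_eq_add] at hw
    exact hw
  have hf' : ∀ l, s ^ l • f = f := fun l => by
    have h := congrArg (· • f) (geom_sum_mul s l)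
    simp only [mul_smul, hf, smul_zero, sub_smul, one_smul] at h
    exact sub_eq_zero.1 h.symm
  have hζ' : ζ = p ^ (n - (i + 1)) • f + (∑ j ∈ range (p ^ n), s ^ j) • w := by
    rw [← hk, smul_add, sum_pow_smul_of_smul_eq (hf' _), smul_smul, hNa, mul_comm (∑ _ ∈ _, _)]
  have hcf : p ^ (n - i) • f = -(p • (∑ j ∈ range (p ^ n), s ^ j) • w) := by
    rw [eq_neg_iff_add_eq_zero, hc, mul_comm, mul_smul, ← smul_add, ← hζ', hpζ]
  -- The relation `p ζ = 0` makes this norm to `K_i` trivial. The resulting `u = (s - 1) y - p w`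
  -- lies in `K_i` and has norm `f` to `F`.
  obtain ⟨y, hy⟩ := h90 i hi.le (f + (∑ j ∈ range (p ^ i), s ^ j) • p • w) (by
    rw [smul_add, sum_pow_smul_of_smul_eq (hf' _), smul_smul, mul_comm (∑ _ ∈ _, _), ← hNr, hcf]
    module)
  have hfu : (∑ j ∈ range (p ^ i), s ^ j) • ((s - 1) • y - p • w) = f := by
    rw [smul_sub, smul_smul, hr, hy]; abel
  have hu : s ^ p ^ i • ((s - 1) • y - p • w) = (s - 1) • y - p • w := by
    rw [← sub_eq_zero]
    generalize (s - 1) • y - p • w = u at *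
    calc _ = (s ^ p ^ i - 1) • u := by module
      _ = (s - 1) • (∑ j ∈ range (p ^ i), s ^ j) • u := by rw [← hr]; module
      _ = 0 := by rw [hfu, hf]
  generalize (s - 1) • y - p • w = u at *
  -- The norm of `u + p w` to `F` is `p^(n-i) f + p N w = 0`.
  obtain ⟨z, hz⟩ := h90 0 (Nat.zero_le _) (u + p • w) (by
    rw [pow_zero, pow_one, Nat.sub_zero, smul_add]
    nth_rewrite 1 [hNr]
    rw [mul_comm, mul_smul, hfu, sum_pow_smul_of_smul_eq (hf' _), hcf]
    module)
  rw [pow_zero, pow_one] at hz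
  obtain ⟨g, hg, hg'⟩ := exists_smul_eq_norm_smul hp hi h2 hz hu
  exact ⟨z, u, w, g, hz, hu, hg, by rw [hg', hfu, hζ', add_comm]⟩

end Descent

/-! ### Hilbert 90 -/

theorem AlgEquiv.exists_mul_eq_of_prod_pow_eq_one {F K : Type*} [Field F] [Field K] [Algebra F K]
    (τ : K ≃ₐ[F] K) {x : Kˣ} {N : ℕ} (hN : orderOf τ = N) (hN0 : N ≠ 0)
    (hx : ∏ j ∈ range N, (τ ^ j) (x : K) = 1) : ∃ y : Kˣ, x * Units.map (τ : K →* K) y = y := by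
  have hli : LinearIndependent K fun j : Fin N => ((τ ^ (j : ℕ) : K ≃ₐ[F] K) : K → K) := by
    refine (linearIndependent_monoidHom K K).comp
      (fun j : Fin N => ((τ ^ (j : ℕ) : K ≃ₐ[F] K) : K →* K)) fun i j h => Fin.ext ?_
    refine pow_injOn_Iio_orderOf (x := τ) (by simp [hN]) (by simp [hN]) (AlgEquiv.ext fun a => ?_)
    exact DFunLike.congr_fun h a
  -- The partial norms satisfy `x τ(c_j) = c_{j+1}`, so multiplying the `τ`-image of the resolvent
  -- `∑ c_j τ^j(θ)` by `x` only shifts its index; independence of the powers of `τ` makes it nonzero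
  -- for some `θ`.
  set c : ℕ → K := fun j => ∏ l ∈ range j, (τ ^ l) (x : K) with hc
  have hcs : ∀ j, x * τ (c j) = c (j + 1) := fun j => by
    simp only [hc, map_prod, prod_range_succ', pow_zero, AlgEquiv.one_apply, pow_succ',
      AlgEquiv.mul_apply]
    exact mul_comm _ _
  obtain ⟨θ, hθ⟩ : ∃ θ, ∑ j ∈ range N, c j * (τ ^ j) θ ≠ 0 := by
    by_contra! H
    have := Fintype.linearIndependent_iff.1 hli (fun j => c j) (by
      ext θ
      have := H θ
      rw [← Fin.sum_univ_eq_sum_range (fun j => c j * (τ ^ j) θ)] at this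
      simpa [Finset.sum_apply] using this)
      ⟨0, Nat.pos_of_ne_zero hN0⟩
    simp [hc] at this
  refine ⟨Units.mk0 _ hθ, Units.ext ?_⟩
  have h0 : ∑ j ∈ range N, c j * (τ ^ j) θ = ∑ j ∈ range N, c (j + 1) * (τ ^ (j + 1)) θ := by
    have h1 := sum_range_succ (fun j => c j * (τ ^ j) θ) N
    rw [sum_range_succ'] at h1
    have h2 : c N = 1 := hx
    have h3 : τ ^ N = 1 := hN ▸ pow_orderOf_eq_one τ
    have h4 : c 0 = 1 := prod_range_zero _
    rw [h2, h3, h4, pow_zero, add_left_inj] at h1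
    exact h1.symm
  simp only [Units.val_mul, Units.coe_map, Units.val_mk0]
  conv_rhs => rw [h0]
  change (x : K) * τ _ = _
  rw [map_sum, mul_sum]
  refine sum_congr rfl fun j _ => ?_
  rw [map_mul, ← mul_assoc, hcs, pow_succ', AlgEquiv.mul_apply]

/-! ### Length as a nilpotency index of `σ - 1` -/

namespace PowerClasses

section Length

variable {k V : Type*} [Field k] [AddCommGroup V] [Module k V]

theorem finrank_span_pow_le (T : Module.End k V) (x : V) (l : ℕ) :
    Module.finrank k (Submodule.span k ((fun j => (T ^ j) x) '' (range l : Set ℕ))) ≤ l := by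
  classical
  rw [← coe_image]
  exact (finrank_span_finset_le_card _).trans (card_image_le.trans (card_range l).le)

theorem span_pow_le_comap {T : Module.End k V} {x : V} {l : ℕ} (h : (T ^ l) x = 0) :
    Submodule.span k ((fun j => (T ^ j) x) '' (range l : Set ℕ)) ≤
      (Submodule.span k ((fun j => (T ^ j) x) '' (range l : Set ℕ))).comap T := by
  rw [Submodule.span_le]
  rintro _ ⟨j, hj, rfl⟩
  simp only [SetLike.mem_coe, Submodule.mem_comap]
  rw [← Module.End.mul_apply, ← pow_succ']
  rcases (Nat.succ_le_of_lt (mem_range.1 hj)).lt_or_eq with hj' | hj'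
  · exact Submodule.subset_span ⟨j + 1, by simpa using hj', rfl⟩
  · rw [← Nat.succ_eq_add_one, hj', h]
    exact Submodule.zero_mem _

/-- On `W` the kernels of the powers of `T` are constant from the exponent `dim W` onwards, and a
large power vanishes. -/
theorem pow_apply_eq_zero_of_finrank_le (T : Module.End k V) (W : Submodule k V)
    [FiniteDimensional k W] (hW : ∀ x ∈ W, T x ∈ W) {N l : ℕ} (hN : ∀ x, (T ^ N) x = 0)
    (hl : Module.finrank k W ≤ l) {x : V} (hx : x ∈ W) : (T ^ l) x = 0 := by
  have hr : ∀ j (y : W), (((T.restrict hW) ^ j) y : V) = (T ^ j) y := fun j y => by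
    rw [Module.End.pow_restrict j hW]; rfl
  have h1 : (⟨x, hx⟩ : W) ∈ LinearMap.ker ((T.restrict hW) ^ (N + Module.finrank k W)) := by
    rw [LinearMap.mem_ker, Subtype.ext_iff, hr, add_comm, pow_add, Module.End.mul_apply, hN]
    simp
  rw [Module.End.ker_pow_eq_ker_pow_finrank_of_le (Nat.le_add_left _ _),
    ← Module.End.ker_pow_eq_ker_pow_finrank_of_le hl, LinearMap.mem_ker, Subtype.ext_iff, hr] at h1
  exact h1

end Length

variable {F K : Type*} [Field F] [Field K] [Algebra F K] {p : ℕ}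

/-- The cyclic submodule generated by `[γ]`, as a subspace of `J`. -/
noncomputable def cyclicSubspace (p : ℕ) (F : Type*) {K : Type*} [Field F] [Field K] [Algebra F K]
    (γ : Kˣ) : Submodule (ZMod p) (PowerClasses p K) :=
  ((cyclicSubmodule p F γ).restrictScalars (ZMod p)).map
    ((galRep p F K).asModuleEquiv : (galRep p F K).asModule →ₗ[ZMod p] PowerClasses p K)

theorem finrank_cyclicSubspace (γ : Kˣ) :
    Module.finrank (ZMod p) (cyclicSubspace p F γ) = length p F γ :=
  LinearEquiv.finrank_map_eq (galRep p F K).asModuleEquiv _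

theorem cls_mem_cyclicSubspace (γ : Kˣ) : cls p γ ∈ cyclicSubspace p F γ :=
  ⟨_, Submodule.subset_span rfl, LinearEquiv.apply_symm_apply _ _⟩

theorem galRep_mem_cyclicSubspace (γ : Kˣ) (τ : K ≃ₐ[F] K) {x : PowerClasses p K}
    (hx : x ∈ cyclicSubspace p F γ) : galRep p F K τ x ∈ cyclicSubspace p F γ := by
  obtain ⟨y, hy, rfl⟩ := hx
  refine ⟨MonoidAlgebra.of (ZMod p) _ τ • y, (cyclicSubmodule p F γ).smul_mem _ hy, ?_⟩
  exact DFunLike.congr_fun ((galRep p F K).asAlgebraHom_of τ) _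

theorem cyclicSubspace_le {γ : Kˣ} {U : Submodule (ZMod p) (PowerClasses p K)}
    (hγ : cls p γ ∈ U) (hU : ∀ τ : K ≃ₐ[F] K, ∀ x ∈ U, galRep p F K τ x ∈ U) :
    cyclicSubspace p F γ ≤ U := by
  rintro _ ⟨y, hy, rfl⟩
  refine Submodule.span_induction (p := fun y _ => (galRep p F K).asModuleEquiv y ∈ U)
    ?_ ?_ ?_ ?_ hy
  · rintro _ rfl
    simpa using hγ
  · simp
  · intro x y _ _ hx hy
    simpa using U.add_mem hx hy
  · intro a x _ hx
    induction a using MonoidAlgebra.induction_on with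
    | of τ =>
      rw [Representation.asModuleEquiv_map_smul, Representation.asAlgebraHom_of]
      exact hU τ _ hx
    | add a b ha hb => rw [add_smul, map_add]; exact U.add_mem ha hb
    | smul r a ha => rw [smul_assoc, map_smul]; exact U.smul_mem _ ha

theorem finiteDimensional_cyclicSubspace [Finite (K ≃ₐ[F] K)] (γ : Kˣ) :
    Module.Finite (ZMod p) (cyclicSubspace p F γ) := by
  have : Module.Finite (MonoidAlgebra (ZMod p) (K ≃ₐ[F] K)) (cyclicSubmodule p F γ) :=
    Module.Finite.span_singleton _ _
  have : Module.Finite (ZMod p) (cyclicSubmodule p F γ) :=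
    Module.Finite.trans (MonoidAlgebra (ZMod p) (K ≃ₐ[F] K)) _
  have : Module.Finite (ZMod p) ((cyclicSubmodule p F γ).restrictScalars (ZMod p)) := this
  exact Module.Finite.map ((cyclicSubmodule p F γ).restrictScalars (ZMod p)) _

/-- The endomorphism `[σ] - 1` of `J`. -/
noncomputable def galSubOne (p : ℕ) (σ : K ≃ₐ[F] K) : Module.End (ZMod p) (PowerClasses p K) :=
  galRep p F K σ - 1

/-- The Frobenius identity in `𝔽_p[X]`, evaluated at the action of `σ`. -/
theorem galSubOne_pow [Fact p.Prime] (σ : K ≃ₐ[F] K) (i : ℕ) :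
    galSubOne p σ ^ p ^ i = galSubOne p (σ ^ p ^ i) := by
  have h := congrArg (Polynomial.aeval (galRep p F K σ))
    (sub_pow_char_pow (Polynomial.X : Polynomial (ZMod p)) 1 (p := p) (n := i))
  simpa [galSubOne] using h

theorem galSubOne_apply (σ : K ≃ₐ[F] K) (x : PowerClasses p K) :
    galSubOne p σ x = galRep p F K σ x - x := rfl

section Cyclic

variable [Fact p.Prime] {σ : K ≃ₐ[F] K} {n : ℕ}

theorem length_le_of_galSubOne_pow_eq_zero [Finite (K ≃ₐ[F] K)] (hσ : ∀ τ, τ ∈ Subgroup.zpowers σ)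
    {γ : Kˣ} {l : ℕ} (h : (galSubOne p σ ^ l) (cls p γ) = 0) : length p F γ ≤ l := by
  set U := Submodule.span (ZMod p) ((fun j => (galSubOne p σ ^ j) (cls p γ)) '' (range l : Set ℕ))
    with hU
  have : Module.Finite (ZMod p) U :=
    Module.Finite.span_of_finite _ ((range l).finite_toSet.image _)
  rw [← finrank_cyclicSubspace]
  refine (Submodule.finrank_mono (cyclicSubspace_le ?_ ?_)).trans
    (finrank_span_pow_le (galSubOne p σ) (cls p γ) l)
  · rcases Nat.eq_zero_or_pos l with rfl | hl
    · rw [pow_zero, Module.End.one_apply] at h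
      rw [h]
      exact zero_mem _
    · exact Submodule.subset_span ⟨0, by simpa using hl, rfl⟩
  · have hstep : ∀ x ∈ U, galRep p F K σ x ∈ U := fun x hx => by
      have := U.add_mem (span_pow_le_comap h hx) hx
      rwa [galSubOne_apply, sub_add_cancel] at this
    intro τ
    obtain ⟨k, rfl⟩ := mem_powers_iff_mem_zpowers.2 (hσ τ)
    induction k with
    | zero => intro x hx; simpa using hx
    | succ k ih =>
      intro x hx
      have := hstep _ (ih x hx)
      rwa [← Module.End.mul_apply, ← map_mul, ← pow_succ'] at this

theorem galSubOne_pow_eq_zero_of_length_le [Finite (K ≃ₐ[F] K)] (hσ : σ ^ p ^ n = 1)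
    {γ : Kˣ} {l : ℕ} (h : length p F γ ≤ l) : (galSubOne p σ ^ l) (cls p γ) = 0 := by
  have := finiteDimensional_cyclicSubspace (p := p) (F := F) γ
  refine pow_apply_eq_zero_of_finrank_le (galSubOne p σ) (cyclicSubspace p F γ)
    (fun x hx => sub_mem (galRep_mem_cyclicSubspace γ σ hx) hx) (N := p ^ n) (fun x => ?_)
    ((finrank_cyclicSubspace γ).le.trans h) (cls_mem_cyclicSubspace γ)
  rw [galSubOne_pow, hσ, galSubOne_apply, map_one, Module.End.one_apply, sub_self]

/-- A cyclic group of order `p^n` has a single subgroup of order `p^(n-i)`, so the supremum defining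
`layer` runs over one field. -/
theorem mem_layer_iff [FiniteDimensional F K] [IsGalois F K]
    (hσ : ∀ τ, τ ∈ Subgroup.zpowers σ) (hn : orderOf σ = p ^ n) {i : ℕ} (hi : i ≤ n) {x : K} :
    x ∈ layer p F K i ↔ (σ ^ p ^ i) x = x := by
  have hp : p.Prime := Fact.out
  have hcard : Nat.card (Subgroup.zpowers (σ ^ p ^ i)) = p ^ (n - i) := by
    rw [Nat.card_zpowers, orderOf_pow_of_dvd (pow_ne_zero _ hp.ne_zero), hn,
      Nat.pow_div hi hp.pos]
    exact hn ▸ pow_dvd_pow p hi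
  have hFK : Module.finrank F K = p ^ n := by
    rw [← IsGalois.card_aut_eq_finrank, ← hn, ← Nat.card_zpowers, (Subgroup.eq_top_iff' _).2 hσ,
      Subgroup.card_top]
  have hmul : p ^ i * p ^ (n - i) = p ^ n := by rw [← pow_add, Nat.add_sub_cancel' hi]
  have hset : {L : IntermediateField F K | Module.finrank F L = p ^ i} =
      {IntermediateField.fixedField (Subgroup.zpowers (σ ^ p ^ i))} := by
    ext L
    rw [Set.mem_ofPred_eq, Set.mem_singleton_iff]
    have hL := Module.finrank_mul_finrank F L K
    rw [hFK, ← hmul] at hL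
    constructor
    · intro h
      rw [h, ← IsGalois.card_fixingSubgroup_eq_finrank] at hL
      have hL' := Nat.eq_of_mul_eq_mul_left (pow_pos hp.pos i) hL
      rw [← IsGalois.fixedField_fixingSubgroup L]
      congr 1
      refine Subgroup.eq_of_le_of_card_ge (fun h hh => ?_) (by rw [hL', hcard])
      obtain ⟨k, rfl⟩ := mem_powers_iff_mem_zpowers.2 (hσ h)
      have h1 : (σ ^ k) ^ p ^ (n - i) = 1 := by
        have := pow_card_eq_one' (x := (⟨σ ^ k, hh⟩ : L.fixingSubgroup))
        rw [hL'] at this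
        exact congrArg Subtype.val this
      rw [← pow_mul] at h1
      have h2 := orderOf_dvd_of_pow_eq_one h1
      rw [hn, ← hmul] at h2
      obtain ⟨c, rfl⟩ := Nat.dvd_of_mul_dvd_mul_right (pow_pos hp.pos _) h2
      change σ ^ (p ^ i * c) ∈ _
      rw [pow_mul]
      exact Subgroup.npow_mem_zpowers _ _
    · rintro rfl
      rw [IntermediateField.finrank_fixedField_eq_card, hcard] at hL
      exact Nat.eq_of_mul_eq_mul_right (pow_pos hp.pos _) hL
  rw [layer, hset, sSup_singleton, IntermediateField.mem_fixedField_iff]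
  refine ⟨fun h => h _ (Subgroup.mem_zpowers _), fun h τ hτ => ?_⟩
  obtain ⟨k, rfl⟩ := mem_powers_iff_mem_zpowers.2 hτ
  change ((σ ^ p ^ i) ^ k) x = x
  induction k with
  | zero => rfl
  | succ k ih =>
    rw [pow_succ, AlgEquiv.mul_apply, h, ih (Subgroup.npow_mem_zpowers _ _)]

end Cyclic

end PowerClasses

/-- On a proper layer `K_i` the norm from `K` is `p^(n-i)` times the norm from `K_i`, and `p`
divides `p^(n-i)`. -/
theorem exists_smul_eq_of_pow_smul_eq {R M : Type*} [CommRing R] [AddCommGroup M] [Module R M]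
    {p n i : ℕ} (hi : i < n) {s : R} (hs : ∀ x : M, s ^ p ^ n • x = x) {x y : M}
    (hx : s ^ p ^ i • x = x) :
    ∃ f : M, s • f = f ∧ p • f = (∑ j ∈ range (p ^ n), s ^ j) • (x - p • y) := by
  have hN := sum_range_mul_pow s (p ^ i) (p ^ (n - i))
  rw [← pow_add, show i + (n - i) = n by omega] at hN
  have hc : p ^ (n - i) = p * p ^ (n - (i + 1)) := by rw [← pow_succ']; congr 1; omega
  have hfix : ∀ (l : ℕ) (a : M), s ^ l • a = a →
      s • (∑ j ∈ range l, s ^ j) • a = (∑ j ∈ range l, s ^ j) • a := fun l a ha => by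
    rw [← sub_eq_zero]
    calc _ = ((∑ j ∈ range l, s ^ j) * (s - 1)) • a := by module
      _ = 0 := by rw [geom_sum_mul, sub_smul, ha, one_smul, sub_self]
  refine ⟨p ^ (n - (i + 1)) • (∑ j ∈ range (p ^ i), s ^ j) • x -
    (∑ j ∈ range (p ^ n), s ^ j) • y, ?_, ?_⟩
  · rw [smul_sub, smul_comm s, hfix _ x hx, hfix _ y (hs y)]
  · have : (∑ j ∈ range (p ^ n), s ^ j) • x =
        (p * p ^ (n - (i + 1))) • (∑ j ∈ range (p ^ i), s ^ j) • x := by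
      rw [hN, mul_smul, sum_pow_smul_of_smul_eq hx, ← hc, smul_comm]
    rw [smul_sub (∑ j ∈ range (p ^ n), s ^ j), this]
    module

/-! ### `K^×` as a `ℤ[X]`-module, and norm classes inside it -/

namespace PowerClasses

variable {F K : Type*} [Field F] [Field K] [Algebra F K] {p n : ℕ} (σ : K ≃ₐ[F] K)

/-- The endomorphism of `K^×`, written additively, induced by `σ`. -/
noncomputable def unitsEnd : Module.End ℤ (Additive Kˣ) :=
  (MonoidHom.toAdditive (Units.map (σ : K →* K))).toIntLinearMap

/-- The action of `ℤ[X]` on `K^×`, written additively, in which `X` acts as `σ`. -/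
@[reducible] noncomputable def unitsModule : Module (Polynomial ℤ) (Additive Kˣ) :=
  Module.compHom (Additive Kˣ) 
    (Polynomial.aeval (R := ℤ) (unitsEnd σ)).toRingHom

theorem X_smul_ofMul (x : Kˣ) : letI := unitsModule σ
    (Polynomial.X : Polynomial ℤ) • Additive.ofMul x =
      Additive.ofMul (Units.map (σ : K →* K) x) := by
  let := unitsModule σ
  change Polynomial.aeval (R := ℤ) (unitsEnd σ) Polynomial.X (Additive.ofMul x) = _
  rw [Polynomial.aeval_X]
  rfl

theorem X_pow_smul_ofMul (k : ℕ) (x : Kˣ) : letI := unitsModule σ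
    (Polynomial.X : Polynomial ℤ) ^ k • Additive.ofMul x =
      Additive.ofMul (Units.map ((σ ^ k : K ≃ₐ[F] K) : K →* K) x) := by
  let := unitsModule σ
  induction k with
  | zero => rw [pow_zero, one_smul]; rfl
  | succ k ih => rw [pow_succ', mul_smul, ih, X_smul_ofMul, pow_succ']; rfl

theorem sum_X_pow_pow_smul_ofMul (a k : ℕ) (x : Kˣ) : letI := unitsModule σ
    (∑ j ∈ range k, ((Polynomial.X : Polynomial ℤ) ^ a) ^ j) • Additive.ofMul x =
      Additive.ofMul (∏ j ∈ range k, Units.map (((σ ^ a) ^ j : K ≃ₐ[F] K) : K →* K) x) := by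
  let := unitsModule σ
  simp_rw [sum_smul, ← pow_mul, X_pow_smul_ofMul]
  rfl

theorem sum_X_pow_smul_ofMul (k : ℕ) (x : Kˣ) : letI := unitsModule σ
    (∑ j ∈ range k, (Polynomial.X : Polynomial ℤ) ^ j) • Additive.ofMul x =
      Additive.ofMul (∏ j ∈ range k, Units.map ((σ ^ j : K ≃ₐ[F] K) : K →* K) x) := by
  simpa using sum_X_pow_pow_smul_ofMul σ 1 k x

variable {σ}

theorem exists_X_pow_sub_one_smul_eq (hp : p.Prime) (hn : orderOf σ = p ^ n) {i : ℕ} (hi : i ≤ n)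
    (x : Additive Kˣ) : letI := unitsModule σ
    (∑ t ∈ range (p ^ (n - i)), ((Polynomial.X : Polynomial ℤ) ^ p ^ i) ^ t) • x = 0 →
      ∃ y : Additive Kˣ, ((Polynomial.X : Polynomial ℤ) ^ p ^ i - 1) • y = x := by
  let := unitsModule σ
  intro hx
  have hord : orderOf (σ ^ p ^ i) = p ^ (n - i) := by
    rw [orderOf_pow_of_dvd (pow_ne_zero _ hp.ne_zero), hn, Nat.pow_div hi hp.pos]
    exact hn ▸ pow_dvd_pow p hi
  obtain ⟨x, rfl⟩ := Additive.ofMul.surjective x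
  rw [sum_X_pow_pow_smul_ofMul] at hx
  obtain ⟨y, hy⟩ := (σ ^ p ^ i).exists_mul_eq_of_prod_pow_eq_one hord (pow_ne_zero _ hp.ne_zero)
    (x := x) (by
      have := congrArg (fun z : Additive Kˣ => ((Additive.toMul z : Kˣ) : K)) hx
      simpa using this)
  refine ⟨-Additive.ofMul y, ?_⟩
  rw [smul_neg, sub_smul, X_pow_smul_ofMul, one_smul, neg_sub, sub_eq_iff_eq_add]
  exact congrArg Additive.ofMul hy.symm

theorem cls_eq_zero_iff {x : Kˣ} : cls p x = 0 ↔ ∃ y : Kˣ, y ^ p = x :=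
  QuotientGroup.eq_one_iff (N := (powMonoidHom p : Kˣ →* Kˣ).range) x

theorem cls_mul (x y : Kˣ) : cls p (x * y) = cls p x + cls p y :=
  map_add (mk p) (Additive.ofMul x) (Additive.ofMul y)

theorem galRep_cls (τ : K ≃ₐ[F] K) (x : Kˣ) :
    galRep p F K τ (cls p x) = cls p (Units.map (τ : K →* K) x) := rfl

theorem cls_eq_iff {x y : Kˣ} : cls p x = cls p y ↔ ∃ v : Kˣ, x = y * v ^ p := by
  rw [← sub_eq_zero, sub_eq_iff_eq_add]
  constructor
  · intro h
    have : cls p (x / y) = 0 := by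
      have h1 : cls p (x / y) + cls p y = 0 + cls p y := by rw [← cls_mul, div_mul_cancel, h]
      exact add_right_cancel h1
    obtain ⟨v, hv⟩ := cls_eq_zero_iff.1 this
    exact ⟨v, by rw [hv, mul_div_cancel]⟩
  · rintro ⟨v, rfl⟩
    rw [cls_mul, cls_eq_zero_iff.2 ⟨v, rfl⟩, add_comm]

section Cyclic

variable [FiniteDimensional F K] [IsGalois F K]

theorem exists_algebraMap_eq (hσ : ∀ τ, τ ∈ Subgroup.zpowers σ) {x : K} (hx : σ x = x) :
    ∃ f : F, algebraMap F K f = x := by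
  refine (IsGalois.mem_bot_iff_fixed (F := F) x).2 fun τ => ?_
  obtain ⟨k, rfl⟩ := mem_powers_iff_mem_zpowers.2 (hσ τ)
  change (σ ^ k) x = x
  induction k with
  | zero => rfl
  | succ k ih => rw [pow_succ, AlgEquiv.mul_apply, hx, ih]

theorem algebraMap_norm_eq_prod (hσ : ∀ τ, τ ∈ Subgroup.zpowers σ) {q : ℕ} (hn : orderOf σ = q)
    (x : K) : algebraMap F K (Algebra.norm F x) = ∏ j ∈ range q, (σ ^ j) x := by
  classical
  rw [Algebra.norm_eq_prod_automorphisms]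
  refine (prod_bij (fun j _ => σ ^ j) (fun _ _ => mem_univ _) ?_ ?_ fun _ _ => rfl).symm
  · intro i hi j hj h
    exact pow_injOn_Iio_orderOf (by simpa [hn] using hi) (by simpa [hn] using hj) h
  · intro τ _
    have hfin : IsOfFinOrder σ := isOfFinOrder_of_finite σ
    obtain ⟨k, hk, rfl⟩ := mem_image.1 (hfin.mem_powers_iff_mem_range_orderOf.1
      (mem_powers_iff_mem_zpowers.2 (hσ τ)))
    exact ⟨k, hn ▸ hk, rfl⟩

/-- Moves the condition from `F` to `K`, where elements of `F^×` are the fixed points of `X`, so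
that the descent can be applied. -/
theorem normCls_eq_zero_iff (hσ : ∀ τ, τ ∈ Subgroup.zpowers σ) (hn : orderOf σ = p ^ n) {z : Kˣ} :
    letI := unitsModule σ
    normCls p F z = 0 ↔ ∃ f : Additive Kˣ, (Polynomial.X : Polynomial ℤ) • f = f ∧
      p • f = (∑ j ∈ range (p ^ n), (Polynomial.X : Polynomial ℤ) ^ j) • Additive.ofMul z := by
  let := unitsModule σ
  rw [normCls, cls_eq_zero_iff, sum_X_pow_smul_ofMul]
  constructor
  · rintro ⟨f, hf⟩
    refine ⟨Additive.ofMul (Units.map (algebraMap F K) f), ?_, ?_⟩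
    · rw [X_smul_ofMul]
      refine congrArg Additive.ofMul (Units.ext ?_)
      exact σ.commutes _
    · refine congrArg Additive.ofMul (Units.ext ?_)
      have := congrArg (fun u : Fˣ => algebraMap F K u) hf
      simpa [algebraMap_norm_eq_prod hσ hn] using this
  · rintro ⟨f, hf, hf'⟩
    obtain ⟨f, rfl⟩ := Additive.ofMul.surjective f
    rw [X_smul_ofMul] at hf
    obtain ⟨g, hg⟩ := exists_algebraMap_eq hσ (x := f)
      (congrArg (fun u : Additive Kˣ => ((Additive.toMul u : Kˣ) : K)) hf)
    have hg0 : g ≠ 0 := by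
      rintro rfl
      exact f.ne_zero (by rw [← hg, map_zero])
    refine ⟨Units.mk0 g hg0, Units.ext ((algebraMap F K).injective ?_)⟩
    have := congrArg (fun u : Additive Kˣ => ((Additive.toMul u : Kˣ) : K)) hf'
    simpa [hg, algebraMap_norm_eq_prod hσ hn] using this

end Cyclic

end PowerClasses

/-! ### Construction of witnesses -/

namespace PowerClasses

variable {F K : Type*} [Field F] [Field K] [Algebra F K] {p n : ℕ} {σ : K ≃ₐ[F] K}

theorem galRep_sub_mem_of_generator [Finite (K ≃ₐ[F] K)] [Fact p.Prime]
    (hσ : ∀ τ, τ ∈ Subgroup.zpowers σ)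
    {A : AddSubgroup (PowerClasses p K)} (hA : ∀ y ∈ A, galRep p F K σ y ∈ A)
    {x : PowerClasses p K} (hx : galSubOne p σ x ∈ A) (τ : K ≃ₐ[F] K) :
    galRep p F K τ x - x ∈ A := by
  obtain ⟨k, rfl⟩ := mem_powers_iff_mem_zpowers.2 (hσ τ)
  change galRep p F K (σ ^ k) x - x ∈ A
  induction k with
  | zero => simp
  | succ k ih =>
    have h : galRep p F K (σ ^ (k + 1)) x - x =
        galRep p F K σ (galRep p F K (σ ^ k) x - x) + galSubOne p σ x := by
      rw [pow_succ', map_mul, Module.End.mul_apply, map_sub, galSubOne_apply]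
      abel
    rw [h]
    exact A.add_mem (hA _ ih) hx

theorem units_map_eq_self_of_pow_eq_one [Fact p.Prime] {ξ : F} (hξ : IsPrimitiveRoot ξ p)
    (τ : K ≃ₐ[F] K) {x : Kˣ} (hx : x ^ p = 1) : Units.map (τ : K →* K) x = x := by
  have : NeZero p := ⟨(Fact.out : p.Prime).ne_zero⟩
  obtain ⟨k, -, hk⟩ := (hξ.map_of_injective (algebraMap F K).injective).eq_pow_of_pow_eq_one
    (ξ := (x : K)) (by rw [← Units.val_pow_eq_pow_val, hx, Units.val_one])
  refine Units.ext ?_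
  change τ x = x
  rw [← hk, ← map_pow, τ.commutes]

theorem X_smul_eq_self_of_nsmul_eq_zero [Fact p.Prime] {ξ : F} (hξ : IsPrimitiveRoot ξ p)
    {x : Additive Kˣ} (hx : p • x = 0) : letI := unitsModule σ
    (Polynomial.X : Polynomial ℤ) • x = x := by
  obtain ⟨x, rfl⟩ := Additive.ofMul.surjective x
  rw [X_smul_ofMul]
  exact congrArg Additive.ofMul (units_map_eq_self_of_pow_eq_one hξ σ hx)

theorem isWitness_bot_iff [Finite (K ≃ₐ[F] K)] [Fact p.Prime] (hσ : ∀ τ, τ ∈ Subgroup.zpowers σ)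
    {δ : Kˣ} : IsWitness p F ⊥ δ ↔ normCls p F δ ≠ 0 ∧ galSubOne p σ (cls p δ) = 0 := by
  refine and_congr_right fun _ => ⟨fun h => h σ, fun h τ => ?_⟩
  refine galRep_sub_mem_of_generator hσ (A := ⊥) (fun y hy => ?_) (AddSubgroup.mem_bot.2 h) τ
  rw [AddSubgroup.mem_bot.1 hy, map_zero]
  exact zero_mem _

section Cyclic

variable [FiniteDimensional F K] [IsGalois F K] [Fact p.Prime]

theorem mem_layerClasses_iff (hσ : ∀ τ, τ ∈ Subgroup.zpowers σ) (hn : orderOf σ = p ^ n) {i : ℕ}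
    (hi : i ≤ n) {y : PowerClasses p K} : y ∈ layerClasses p F K (i : WithBot ℕ) ↔
      ∃ u : Kˣ, Units.map ((σ ^ p ^ i : K ≃ₐ[F] K) : K →* K) u = u ∧ cls p u = y := by
  constructor
  · rintro ⟨u, ⟨w, hw⟩, rfl⟩
    refine ⟨Additive.toMul u, Units.ext ((mem_layer_iff hσ hn hi).1 ?_), rfl⟩
    rw [← hw]
    exact w.1.2
  · rintro ⟨u, hu, rfl⟩
    have hu' : (u : K) ∈ layer p F K i := (mem_layer_iff hσ hn hi).2 (congrArg Units.val hu)
    refine ⟨Additive.ofMul u, ⟨Units.mk0 ⟨u, hu'⟩ fun h => u.ne_zero (congrArg Subtype.val h),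
      Units.ext rfl⟩, rfl⟩

theorem isWitness_natCast_iff (hσ : ∀ τ, τ ∈ Subgroup.zpowers σ) (hn : orderOf σ = p ^ n) {i : ℕ}
    (hi : i ≤ n) {δ : Kˣ} : IsWitness p F (i : WithBot ℕ) δ ↔ normCls p F δ ≠ 0 ∧
      galSubOne p σ (cls p δ) ∈ layerClasses p F K (i : WithBot ℕ) := by
  refine and_congr_right fun _ => ⟨fun h => h σ, fun h τ => ?_⟩
  refine galRep_sub_mem_of_generator hσ (fun y hy => ?_) h τ
  obtain ⟨u, hu, rfl⟩ := (mem_layerClasses_iff hσ hn hi).1 hy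
  refine (mem_layerClasses_iff hσ hn hi).2 ⟨Units.map (σ : K →* K) u, ?_, rfl⟩
  refine Units.ext ?_
  have h1 := congrArg (fun w : Kˣ => σ w) hu
  change (σ ^ p ^ i) (σ u) = σ u
  change σ ((σ ^ p ^ i) u) = σ u at h1
  rwa [← AlgEquiv.mul_apply, ← pow_succ, pow_succ', AlgEquiv.mul_apply]

/-- A `p`-th root `f` of `N(z)` in `F` would differ from `g` by a `p`-th root of unity, which is
fixed by `X`; then `g` would be fixed too, against `ζ ≠ 0`. -/
theorem isWitness_of_smul_eq (hσ : ∀ τ, τ ∈ Subgroup.zpowers σ) (hn : orderOf σ = p ^ n) {ξ : F}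
    (hξ : IsPrimitiveRoot ξ p) {i : ℕ} (hi : i ≤ n) {z u v g ζ : Additive Kˣ} (hζ : ζ ≠ 0) :
    letI := unitsModule σ
    ((Polynomial.X : Polynomial ℤ) - 1) • z = u + p • v →
    (Polynomial.X : Polynomial ℤ) ^ p ^ i • u = u →
    p • g = (∑ j ∈ range (p ^ n), (Polynomial.X : Polynomial ℤ) ^ j) • z →
    ((Polynomial.X : Polynomial ℤ) - 1) • g = ζ → IsWitness p F (i : WithBot ℕ) z.toMul := by
  let := unitsModule σ
  intro hz hu hg hgζ
  rw [isWitness_natCast_iff hσ hn hi, Ne, normCls_eq_zero_iff hσ hn]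
  constructor
  · rintro ⟨f, hf, hf'⟩
    rw [ofMul_toMul, ← hg] at hf'
    have h1 := X_smul_eq_self_of_nsmul_eq_zero (σ := σ) hξ (x := f - g) (by
      rw [nsmul_sub, hf', sub_self])
    rw [smul_sub, hf, sub_right_inj] at h1
    exact hζ (by rw [← hgζ, sub_smul, h1, one_smul, sub_self])
  · obtain ⟨u, rfl⟩ := Additive.ofMul.surjective u
    obtain ⟨z, rfl⟩ := Additive.ofMul.surjective z
    rw [X_pow_smul_ofMul] at hu
    refine (mem_layerClasses_iff hσ hn hi).2 ⟨u, congrArg Additive.toMul hu, ?_⟩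
    rw [galSubOne_apply, toMul_ofMul, galRep_cls, eq_sub_iff_add_eq, ← cls_mul, eq_comm, cls_eq_iff]
    refine ⟨v.toMul, ?_⟩
    rw [sub_smul, one_smul, X_smul_ofMul, sub_eq_iff_eq_add, add_right_comm] at hz
    exact congrArg Additive.toMul hz

theorem exists_isWitness_of_norm (hσ : ∀ τ, τ ∈ Subgroup.zpowers σ) (hn : orderOf σ = p ^ n)
    {ξ : F} (hξ : IsPrimitiveRoot ξ p) (h2 : p = 2 → 1 < n) {i : ℕ} (hi : i < n)
    {ζ k : Additive Kˣ} (hζ : ζ ≠ 0) (hpζ : p • ζ = 0) :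
    letI := unitsModule σ
    (∑ t ∈ range (p ^ (n - (i + 1))), ((Polynomial.X : Polynomial ℤ) ^ p ^ (i + 1)) ^ t) • k = ζ →
    ∃ δ : Kˣ, IsWitness p F (i : WithBot ℕ) δ := by
  let := unitsModule σ
  intro hk
  obtain ⟨z, u, v, g, h1, hu, h3, h4⟩ := exists_descent (Fact.out : p.Prime) hi h2
    (fun j hj x => exists_X_pow_sub_one_smul_eq Fact.out hn hj x)
    (X_smul_eq_self_of_nsmul_eq_zero hξ hpζ) hpζ hk
  exact ⟨_, isWitness_of_smul_eq hσ hn hξ hi.le hζ h1 hu h3 h4⟩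

theorem exists_isWitness_of_length_le (hσ : ∀ τ, τ ∈ Subgroup.zpowers σ) (hn : orderOf σ = p ^ n)
    {ξ : F} (hξ : IsPrimitiveRoot ξ p) {i : ℕ} (hi : i + 1 < n) {z : Kˣ}
    (hz : normCls p F z ≠ 0) (hl : length p F z ≤ p ^ (i + 1)) :
    ∃ δ : Kˣ, IsWitness p F (i : WithBot ℕ) δ := by
  let := unitsModule σ
  have hs : ∀ x : Additive Kˣ, (Polynomial.X : Polynomial ℤ) ^ p ^ n • x = x := fun x => by
    obtain ⟨x, rfl⟩ := Additive.ofMul.surjective x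
    rw [X_pow_smul_ofMul, ← hn, pow_orderOf_eq_one]
    rfl
  have h0 := galSubOne_pow_eq_zero_of_length_le (hn ▸ pow_orderOf_eq_one σ : σ ^ p ^ n = 1) hl
  rw [galSubOne_pow, galSubOne_apply, galRep_cls, sub_eq_zero, cls_eq_iff] at h0
  obtain ⟨k, hk⟩ := h0
  have hk' : (Polynomial.X : Polynomial ℤ) ^ p ^ (i + 1) • Additive.ofMul z =
      Additive.ofMul z + p • Additive.ofMul k := by
    rw [X_pow_smul_ofMul, hk]
    rfl
  have hpow : ((Polynomial.X : Polynomial ℤ) ^ p ^ (i + 1)) ^ p ^ (n - (i + 1)) =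
      Polynomial.X ^ p ^ n := by
    rw [← pow_mul, ← pow_add]
    congr 2
    omega
  refine exists_isWitness_of_norm hσ hn hξ (fun _ => by omega) (by omega : i < n) ?_ ?_
    (k := Additive.ofMul k) rfl
  -- If the root of unity were trivial, `z` would differ by a `p`-th power from an element of
  -- `K_{i+1}`, a proper subfield.
  · intro h
    obtain ⟨y, hy⟩ := exists_X_pow_sub_one_smul_eq Fact.out hn hi.le _ h
    obtain ⟨f, hf, hf'⟩ := exists_smul_eq_of_pow_smul_eq hi hs
      (x := Additive.ofMul z - p • y) (y := -y) (by
        rw [smul_sub, hk', ← hy]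
        module)
    refine hz ((normCls_eq_zero_iff hσ hn).2 ⟨f, hf, ?_⟩)
    rw [hf']
    congr 1
    module
  · rw [smul_comm, show p • Additive.ofMul k =
      ((Polynomial.X : Polynomial ℤ) ^ p ^ (i + 1) - 1) • Additive.ofMul z by
        rw [sub_smul, hk', one_smul, add_sub_cancel_left], smul_smul, geom_sum_mul, hpow, sub_smul,
      hs, one_smul, sub_self]

theorem exists_isWitness_pred (hσ : ∀ τ, τ ∈ Subgroup.zpowers σ) (hn : orderOf σ = p ^ n)
    {ξ : F} (hξ : IsPrimitiveRoot ξ p) (hn1 : 1 ≤ n)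
    (h2 : p = 2 → 1 < n ∨ ∃ x : K, Algebra.norm F x = -1) :
    ∃ δ : Kˣ, IsWitness p F ((n - 1 : ℕ) : WithBot ℕ) δ := by
  let := unitsModule σ
  have hp : p.Prime := Fact.out
  have hξ0 : ξ ≠ 0 := hξ.ne_zero hp.ne_zero
  have hpζ : p • Additive.ofMul (Units.map (algebraMap F K : F →* K) (Units.mk0 ξ hξ0)) = 0 := by
    refine congrArg Additive.ofMul (Units.ext ?_)
    change algebraMap F K ξ ^ p = 1
    rw [← map_pow, hξ.pow_eq_one, map_one]
  have hζ : Additive.ofMul (Units.map (algebraMap F K : F →* K) (Units.mk0 ξ hξ0)) ≠ 0 := by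
    intro h
    have h1 : algebraMap F K ξ = 1 := congrArg (fun u : Additive Kˣ => ((u.toMul : Kˣ) : K)) h
    exact hξ.ne_one hp.one_lt ((algebraMap F K).injective (h1.trans (map_one _).symm))
  have hζX := X_smul_eq_self_of_nsmul_eq_zero (σ := σ) hξ hpζ
  have hζv : p = 2 → algebraMap F K ξ = -1 := by
    rintro rfl
    rw [hξ.eq_neg_one_of_two_right, map_neg, map_one]
  by_cases h2' : p = 2 → 1 < n
  · refine exists_isWitness_of_norm hσ hn hξ h2' (by omega) hζ hpζ
      -- At level `n` the norm is the identity, so `k = ζ` serves.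
      (k := Additive.ofMul (Units.map (algebraMap F K : F →* K) (Units.mk0 ξ hξ0))) ?_
    rw [Nat.sub_add_cancel hn1, Nat.sub_self, pow_zero, sum_range_one, pow_zero, one_smul]
  · push Not at h2'
    obtain ⟨rfl, hn1'⟩ := h2'
    obtain rfl : n = 1 := by omega
    obtain ⟨x, hx⟩ := (h2 rfl).resolve_left (by omega)
    have hx0 : x ≠ 0 := by
      rintro rfl
      rw [Algebra.norm_zero] at hx
      exact one_ne_zero (neg_eq_zero.1 hx.symm)
    have hsum : ∀ y : Additive Kˣ, (∑ j ∈ range (2 ^ 1), (Polynomial.X : Polynomial ℤ) ^ j) • y =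
        y + (Polynomial.X : Polynomial ℤ) • y := fun y => by
      simp [sum_range_succ, add_smul]
    have hxN : Additive.ofMul (Units.mk0 x hx0) +
        (Polynomial.X : Polynomial ℤ) • Additive.ofMul (Units.mk0 x hx0) =
          Additive.ofMul (Units.map (algebraMap F K : F →* K) (Units.mk0 ξ hξ0)) := by
      rw [← hsum, sum_X_pow_smul_ofMul]
      refine congrArg Additive.ofMul (Units.ext ?_)
      have := algebraMap_norm_eq_prod hσ hn x
      rw [hx, map_neg, map_one, ← hζv rfl] at this
      simpa using this.symm
    generalize Additive.ofMul (Units.map (algebraMap F K : F →* K) (Units.mk0 ξ hξ0)) = ζ at *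
    generalize Additive.ofMul (Units.mk0 x hx0) = x at *
    obtain ⟨e, he⟩ := exists_X_pow_sub_one_smul_eq hp hn (Nat.zero_le 1) ζ (by
      simp only [pow_zero, pow_one, Nat.sub_zero]
      rw [← pow_one 2, hsum, hζX, ← two_nsmul, hpζ])
    rw [pow_zero, pow_one] at he
    have he' : (Polynomial.X : Polynomial ℤ) • e = e + ζ := by rw [← he]; module
    have hx' : (Polynomial.X : Polynomial ℤ) • x = ζ - x := by rw [← hxN]; abel
    rw [two_nsmul] at hpζ
    -- Multiplicatively, `σ e = -e` and `N(x) = -1`, so `z = e x` has norm `e²` although `e` is not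
    -- in `F`. Moreover `z^(σ-1) = x^(-2)`, a square.
    refine ⟨_, isWitness_of_smul_eq (u := 0) (v := -x) (z := e + x) (g := e) hσ hn hξ
      (Nat.sub_le _ _) hζ ?_ (smul_zero _) ?_ he⟩
    · rw [sub_smul, smul_add, he', hx', one_smul]
      calc _ = (ζ + ζ) + 2 • (-x) := by abel
        _ = _ := by rw [hpζ]
    · rw [hsum, smul_add, he', hx']
      calc _ = 2 • e + 0 := by abel
        _ = 2 • e + (ζ + ζ) := by rw [hpζ]
        _ = _ := by abel

/-! ### Bounds on the length and the conclusion -/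

theorem length_le_of_isWitness (hσ : ∀ τ, τ ∈ Subgroup.zpowers σ) (hn : orderOf σ = p ^ n)
    {m : WithBot ℕ} (hm : m ≤ n) {δ : Kˣ} (hδ : IsWitness p F m δ) :
    length p F δ ≤ botPow p m + 1 := by
  refine length_le_of_galSubOne_pow_eq_zero hσ ?_
  rw [pow_succ, Module.End.mul_apply]
  induction m with
  | bot => rw [((isWitness_bot_iff hσ).1 hδ).2, map_zero]
  | coe i =>
    have hi : i ≤ n := WithBot.coe_le_coe.1 hm
    obtain ⟨u, hu, hu'⟩ := (mem_layerClasses_iff hσ hn hi).1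
      ((isWitness_natCast_iff hσ hn hi).1 hδ).2
    change (galSubOne p σ ^ p ^ i) _ = 0
    rw [← hu', galSubOne_pow, galSubOne_apply, galRep_cls, hu, sub_self]

theorem lt_length_of_normCls_ne_zero (hσ : ∀ τ, τ ∈ Subgroup.zpowers σ) (hn : orderOf σ = p ^ n)
    {ξ : F} (hξ : IsPrimitiveRoot ξ p) {m : WithBot ℕ} (hmn : m < n)
    (hm : ∀ i : WithBot ℕ, i < m → ∀ δ : Kˣ, ¬ IsWitness p F i δ) {z : Kˣ}
    (hz : normCls p F z ≠ 0) : botPow p m < length p F z := by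
  by_contra! hl
  induction m with
  | bot =>
    have h0 := galSubOne_pow_eq_zero_of_length_le (hn ▸ pow_orderOf_eq_one σ : σ ^ p ^ n = 1) hl
    change (galSubOne p σ ^ 0) _ = 0 at h0
    rw [pow_zero, Module.End.one_apply, cls_eq_zero_iff] at h0
    obtain ⟨y, rfl⟩ := h0
    refine hz (cls_eq_zero_iff.2 ⟨Units.map (Algebra.norm F : K →* F) y, ?_⟩)
    rw [map_pow]
  | coe i =>
    have hin : i < n := WithBot.coe_lt_coe.1 hmn
    change length p F z ≤ p ^ i at hl
    -- At `m = 0`, length at most `1` means that `[z]` is fixed, so `z` itself is a witness at `-∞`;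
    -- above that, the descent gives one at the preceding level.
    obtain _ | i := i
    · have h0 := galSubOne_pow_eq_zero_of_length_le (hn ▸ pow_orderOf_eq_one σ : σ ^ p ^ n = 1) hl
      rw [pow_zero, pow_one] at h0
      exact hm ⊥ (WithBot.bot_lt_coe _) z ((isWitness_bot_iff hσ).2 ⟨hz, h0⟩)
    · obtain ⟨δ, hδ⟩ := exists_isWitness_of_length_le hσ hn hξ hin hz hl
      exact hm i (WithBot.coe_lt_coe.2 i.lt_succ_self) δ hδ

end Cyclic

end PowerClasses

end

theorem proposition7 {F K : Type*} [Field F] [Field K] [Algebra F K]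
    [FiniteDimensional F K] [IsGalois F K] [IsCyclic (K ≃ₐ[F] K)]
    (p n : ℕ) [Fact p.Prime] (hn : 1 ≤ n) (hcard : Nat.card (K ≃ₐ[F] K) = p ^ n)
    (hξ : ∃ ξ : F, IsPrimitiveRoot ξ p)
    (h2 : p = 2 → 1 < n ∨ ∃ x : K, Algebra.norm F x = -1) :
    -- the minimum defining `i(K/F)` exists, and `i(K/F) < n`
    IsLeast (PowerClasses.indexSet p n F K) (PowerClasses.index p n F K) ∧
    PowerClasses.index p n F K < (n : WithBot ℕ) ∧
    -- every exceptional element has length `p ^ m + 1`, where `m = i(K/F)`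
    (∀ δ : Kˣ, PowerClasses.IsExceptional p n F δ →
      PowerClasses.length p F δ = PowerClasses.botPow p (PowerClasses.index p n F K) + 1) ∧
    -- `p ^ m + 1` is the minimal length of all `z` with `[N_{K/F}(z)]_F ≠ [1]_F`
    IsLeast {l : ℕ | ∃ z : Kˣ, PowerClasses.normCls p F z ≠ 0 ∧ PowerClasses.length p F z = l}
      (PowerClasses.botPow p (PowerClasses.index p n F K) + 1) := by
  obtain ⟨σ, hσ⟩ := IsCyclic.exists_generator (α := K ≃ₐ[F] K)
  obtain ⟨ξ, hξ⟩ := hξ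
  have hord : orderOf σ = p ^ n := by
    rw [← hcard, ← Nat.card_zpowers, (Subgroup.eq_top_iff' _).2 hσ, Subgroup.card_top]
  have hpred : ((n - 1 : ℕ) : WithBot ℕ) ∈ PowerClasses.indexSet p n F K :=
    ⟨WithBot.coe_le_coe.2 (Nat.sub_le n 1),
      PowerClasses.exists_isWitness_pred hσ hord hξ hn h2⟩
  have hne : (PowerClasses.indexSet p n F K).Nonempty := ⟨_, hpred⟩
  have hleast : IsLeast (PowerClasses.indexSet p n F K) (PowerClasses.index p n F K) := by
    rw [PowerClasses.index, dif_pos hne]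
    exact ⟨WellFounded.min_mem _ _ _, fun i hi => not_lt.1 (WellFounded.not_lt_min _ _ hi)⟩
  have hlt : PowerClasses.index p n F K < (n : WithBot ℕ) :=
    (hleast.2 hpred).trans_lt (WithBot.coe_lt_coe.2 (Nat.sub_lt hn one_pos))
  have hlower : ∀ z : Kˣ, PowerClasses.normCls p F z ≠ 0 →
      PowerClasses.botPow p (PowerClasses.index p n F K) + 1 ≤ PowerClasses.length p F z :=
    fun z hz => PowerClasses.lt_length_of_normCls_ne_zero hσ hord hξ hlt
      (fun i hi δ hδ => (hleast.2 ⟨hi.le.trans hlt.le, δ, hδ⟩).not_gt hi) hz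
  have hexc : ∀ δ : Kˣ, PowerClasses.IsExceptional p n F δ →
      PowerClasses.length p F δ = PowerClasses.botPow p (PowerClasses.index p n F K) + 1 :=
    fun δ hδ => (PowerClasses.length_le_of_isWitness hσ hord hlt.le hδ).antisymm (hlower δ hδ.1)
  obtain ⟨δ, hδ⟩ := hleast.1.2
  refine ⟨hleast, hlt, hexc, ⟨δ, hδ.1, hexc δ hδ⟩, ?_⟩
  rintro _ ⟨z, hz, rfl⟩
  exact hlower z hz
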